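/- Let $\dim$ denote any one of the following dimensions of subsets of the Euclidean plane: Hausdorff, lower box, upper box, box, or packing dimension (for the box dimension, "$\dim A=\beta$" means that the defining limit exists and equals $\beta$). For a function $g:[0,1]\to\mathbb R$ let $G_g=\{(x,g(x)):x\in[0,1]\}\subset\mathbb R^2$, and let $S_\beta$ be the set of continuous $g:[0,1]\to\mathbb R$ with $\dim G_g=\beta$. Let $1\le\beta\le 2$, let $k\ge 1$ be an integer and let $f:[0,1]\to\mathbb R$ be $k$ times continuously differentiable with $\dim G_{f^{(k)}}=\beta$ (the case $k=1$: $f$ is $C^1$ and $\dim G_{f'}=\beta$). For continuous $g:[0,1]\to\mathbb R$ let $I_kg$ denote the $k$-fold integral of $g$ with the initial values of $f$, i.e. the function with $(I_kg)^{(k)}=g$ and $(I_kg)^{(j)}(0)=f^{(j)}(0)$ for $0\le j<k$; for $k=1$, $I_1g(x)=f(0)+\int_0^x g(t)\,dt$. Then: 1. There are functions $g_n\in S_\beta$, $g_n\ne f^{(k)}$, converging uniformly on $[0,1]$ to $f^{(k)}$, such that the functions $f_n=I_kg_n$ are $k$ times continuously differentiable, satisfy $f_n^{(k)}=g_n$ and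 $\dim G_{f_n^{(k)}}=\beta$ for all $n$, and converge to $f$ uniformly on $[0,1]$. 2. More precisely, for every sequence $(g_n)$ in $S_\beta$ that converges uniformly to $f^{(k)}$, the functions $f_n=I_kg_n$ are $k$ times continuously differentiable, satisfy $f_n^{(k)}=g_n$ and $\dim G_{f_n^{(k)}}=\beta$ for all $n$, and converge to $f$ uniformly on $[0,1]$. Moreover (for this $\beta$, attained by $f^{(k)}$) the set $S_\beta$ from which the $g_n$ are taken is dense in $C[0,1]$ with the supremum norm. -/

import Mathlib

open Set Filter Topology MeasureTheory
open scoped NNReal ENNReal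

noncomputable section

namespace FractalApprox

/-- `N_δ(F)`: the smallest number of sets of diameter at most `δ` that cover `F`
(a genuine minimum as soon as `F` is totally bounded, in particular if `F` is compact). -/
def coverCount {X : Type*} [MetricSpace X] (δ : ℝ) (F : Set X) : ℕ :=
  sInf {n : ℕ | ∃ U : Fin n → Set X,
    (∀ i, Metric.ediam (U i) ≤ ENNReal.ofReal δ) ∧ F ⊆ ⋃ i, U i}

/-- The quotient `log N_δ(F) / (-log δ)`. -/
def boxQuotient {X : Type*} [MetricSpace X] (F : Set X) (δ : ℝ) : ℝ :=
  Real.log (coverCount δ F : ℝ) / (-Real.log δ)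

/-- Lower box dimension. -/
def lowerBoxDim {X : Type*} [MetricSpace X] (F : Set X) : EReal :=
  liminf (fun δ : ℝ => (boxQuotient F δ : EReal)) (𝓝[>] (0 : ℝ))

/-- Upper box dimension. -/
def upperBoxDim {X : Type*} [MetricSpace X] (F : Set X) : EReal :=
  limsup (fun δ : ℝ => (boxQuotient F δ : EReal)) (𝓝[>] (0 : ℝ))

/-- `P^s_δ(F)`: the supremum of `∑ |B_i|^s` over all countable families of pairwise disjoint
balls `B_i` of radius at most `δ` with centres in `F`. The families are indexed by the subsets
`J` of `ℕ`, so finite and empty families are included. -/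
def packingPre {X : Type*} [MetricSpace X] (s δ : ℝ) (F : Set X) : ℝ≥0∞ :=
  ⨆ (c : ℕ → X) (r : ℕ → ℝ) (J : Set ℕ)
    (_ : ∀ i ∈ J, c i ∈ F ∧ 0 < r i ∧ r i ≤ δ)
    (_ : J.PairwiseDisjoint fun i => Metric.closedBall (c i) (r i)),
    ∑' i : J, Metric.ediam (Metric.closedBall (c i) (r i)) ^ s

/-- `P^s_0(F)`, the limit of `P^s_δ(F)` as `δ → 0+`, which is an infimum by monotonicity. -/
def packingPreZero {X : Type*} [MetricSpace X] (s : ℝ) (F : Set X) : ℝ≥0∞ :=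
  ⨅ (δ : ℝ) (_ : 0 < δ), packingPre s δ F

/-- The `s`-dimensional packing measure `P^s(F)`. -/
def packingMeasure {X : Type*} [MetricSpace X] (s : ℝ) (F : Set X) : ℝ≥0∞ :=
  ⨅ (t : ℕ → Set X) (_ : F ⊆ ⋃ i, t i), ∑' i, packingPreZero s (t i)

/-- The packing dimension `inf {s ≥ 0 : P^s(F) = 0}`. -/
def packingDim {X : Type*} [MetricSpace X] (F : Set X) : ℝ≥0∞ :=
  ⨅ (s : ℝ≥0) (_ : packingMeasure (s : ℝ) F = 0), (s : ℝ≥0∞)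

/-- The fractal dimensions under consideration. -/
inductive FractalDimension : Type
  | hausdorff
  | lowerBox
  | upperBox
  | box
  | packing

/-- `D.HasDim F β`: the dimension of kind `D` of `F` is `β`. For the box dimension this means
that the limit defining it exists and equals `β`. -/
def FractalDimension.HasDim {X : Type*} [MetricSpace X] (D : FractalDimension)
    (F : Set X) (β : ℝ) : Prop :=
  match D with
  | .hausdorff => ((dimH F : ℝ≥0∞) : EReal) = (β : EReal)
  | .lowerBox => lowerBoxDim F = (β : EReal)
  | .upperBox => upperBoxDim F = (β : EReal)
  | .box => Tendsto (boxQuotient F) (𝓝[>] (0 : ℝ)) (𝓝 β)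
  | .packing => ((packingDim F : ℝ≥0∞) : EReal) = (β : EReal)

/-- The graph `{(x, g x) : x ∈ [0,1]}` in the Euclidean plane. -/
def graph01 (g : ℝ → ℝ) : Set (EuclideanSpace ℝ (Fin 2)) :=
  (fun x : ℝ => !₂[x, g x]) '' Icc (0 : ℝ) 1

/-- `S_β`: the continuous functions on `[0,1]` whose graph has dimension `β`. A function on
`[0,1]` is represented by a function on `ℝ`, only the values on `[0,1]` being relevant. -/
def S (D : FractalDimension) (β : ℝ) : Set (ℝ → ℝ) :=
  {g | ContinuousOn g (Icc 0 1) ∧ D.HasDim (graph01 g) β}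

/-- The `k`-fold integral of `g` from `0`, with initial values `a 0, …, a (k - 1)` for the
function and its derivatives of order below `k` at `0`. For `k = 1` it is
`x ↦ a 0 + ∫ t in 0..x, g t`. -/
def iteratedPrimitive (g : ℝ → ℝ) : ℕ → (ℕ → ℝ) → ℝ → ℝ
  | 0, _ => g
  | k + 1, a => fun x => a 0 + ∫ t in (0 : ℝ)..x, iteratedPrimitive g k (fun j => a (j + 1)) t

end FractalApprox

end

/-! Each of these dimensions is invariant under bi-Lipschitz maps of the plane, at least on totally
bounded sets (`FractalDimension.HasDim.image_of_lipschitz`). For `c ≠ 0` and `q` Lipschitz, the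
shear `(x, y) ↦ (x, c y + q x)` is bi-Lipschitz and carries the graph of `g` to that of `c g + q`,
so `S D β` is stable under `g ↦ c g + q` (`S_mul_add_lipschitz`). Density follows from one member
`g`: take `q` Lipschitz and close to the target, and `c` so small that `c g` is negligible.

Integration from `0` does not increase the supremum norm on `[0,1]`, so uniform convergence to the
`k`-th derivative passes to the `k`-fold integrals with the same initial values
(`abs_iteratedPrimitive_sub_le`). Adding the constants `1 / (n + 1)` to the `k`-th derivative gives
explicit approximants distinct from it. -/

namespace FractalApprox

/-! ### Box dimensions under Lipschitz maps. -/

section LipschitzInvariance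

variable {X Y : Type*} [MetricSpace X] [MetricSpace Y]

lemma exists_finite_cover_of_totallyBounded {F : Set X} (hF : TotallyBounded F) {δ : ℝ}
    (hδ : 0 < δ) : ∃ n : ℕ, ∃ U : Fin n → Set X,
      (∀ i, Metric.ediam (U i) ≤ ENNReal.ofReal δ) ∧ F ⊆ ⋃ i, U i := by
  obtain ⟨t, ht, hFt⟩ := Metric.totallyBounded_iff.1 hF (δ / 2) (half_pos hδ)
  obtain ⟨n, e, -, rfl⟩ := ht.fin_param
  refine ⟨n, fun i => Metric.ball (e i) (δ / 2), fun i => ?_, by simpa using hFt⟩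
  refine Metric.ediam_le fun x hx y hy => ?_
  rw [edist_dist]
  refine ENNReal.ofReal_le_ofReal ?_
  have := dist_triangle_right x y (e i)
  rw [Metric.mem_ball] at hx hy
  linarith

lemma coverCount_image_le {K : ℝ≥0} {φ : X → Y} (hφ : LipschitzWith K φ) {F : Set X}
    (hF : TotallyBounded F) {δ : ℝ} (hδ : 0 < δ) :
    coverCount (K * δ) (φ '' F) ≤ coverCount δ F := by
  -- Total boundedness makes the set of admissible cardinalities nonempty, so the infimum is
  -- attained and is not the default `sInf ∅ = 0`.
  obtain ⟨U, hU, hFU⟩ := Nat.sInf_mem (exists_finite_cover_of_totallyBounded hF hδ)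
  refine Nat.sInf_le ⟨fun i => φ '' U i, fun i => ?_,
    (image_mono hFU).trans (image_iUnion (f := φ) (s := U)).subset⟩
  calc Metric.ediam (φ '' U i) ≤ K * Metric.ediam (U i) := hφ.ediam_image_le _
    _ ≤ K * ENNReal.ofReal δ := by gcongr; exact hU i
    _ = ENNReal.ofReal (K * δ) := by
      rw [ENNReal.ofReal_mul K.coe_nonneg, ENNReal.ofReal_coe_nnreal]

lemma tendsto_log_div_log_mul {K : ℝ} (hK : 0 < K) :
    Tendsto (fun δ : ℝ => Real.log δ / Real.log (K * δ)) (𝓝[>] 0) (𝓝 1) := by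
  have h : Tendsto (fun δ : ℝ => (Real.log K / Real.log δ + 1)⁻¹) (𝓝[>] 0) (𝓝 (0 + 1)⁻¹) :=
    ((Real.tendsto_log_nhdsGT_zero.const_div_atBot _).add_const 1).inv₀ (by norm_num)
  rw [zero_add, inv_one] at h
  refine h.congr' ?_
  filter_upwards [Ioo_mem_nhdsGT one_pos] with δ hδ
  have : Real.log δ ≠ 0 := (Real.log_neg hδ.1 hδ.2).ne
  rw [Real.log_mul hK.ne' hδ.1.ne', ← inv_div (_ + _), add_div, div_self this]

/-- Passing from scale `δ` to `K * δ` only changes the denominator of the quotient, by a factor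
tending to `1`. -/
lemma boxQuotient_image_le {K : ℝ≥0} (hK : 0 < K) {φ : X → Y} (hφ : LipschitzWith K φ)
    {F : Set X} (hF : TotallyBounded F) :
    ∀ᶠ δ in 𝓝[>] (0 : ℝ), boxQuotient (φ '' F) (K * δ) ≤
      boxQuotient F δ * (Real.log δ / Real.log (K * δ)) := by
  have hK' : (0 : ℝ) < K := hK
  filter_upwards [Ioo_mem_nhdsGT one_pos, Ioo_mem_nhdsGT (inv_pos.2 hK')] with δ hδ hδ'
  have h₁ : Real.log δ < 0 := Real.log_neg hδ.1 hδ.2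
  have h₂ : Real.log (K * δ) < 0 := by
    refine Real.log_neg (mul_pos hK' hδ.1) ?_
    have := mul_lt_mul_of_pos_left hδ'.2 hK'
    rwa [mul_inv_cancel₀ hK'.ne'] at this
  have h₃ : Real.log (coverCount (K * δ) (φ '' F)) ≤ Real.log (coverCount δ F) := by
    have hle := coverCount_image_le hφ hF hδ.1
    -- A zero count (empty image) is harmless because `Real.log 0 = 0`.
    rcases Nat.eq_zero_or_pos (coverCount (K * δ) (φ '' F)) with h0 | h0
    · rw [h0, Nat.cast_zero, Real.log_zero]
      exact Real.log_natCast_nonneg _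
    · exact Real.log_le_log (by exact_mod_cast h0) (by exact_mod_cast hle)
  have h₄ : boxQuotient F δ * (Real.log δ / Real.log (K * δ)) =
      Real.log (coverCount δ F) / (-Real.log (K * δ)) := by
    unfold boxQuotient
    have := h₁.ne
    have := h₂.ne
    field_simp
  rw [h₄]
  exact div_le_div_of_nonneg_right h₃ (by linarith)

lemma map_mul_left_nhdsGT_zero {K : ℝ} (hK : 0 < K) :
    map (K * ·) (𝓝[>] (0 : ℝ)) = 𝓝[>] 0 := by
  conv_lhs => rw [← comap_mulLeft_nhdsGT_zero hK]
  exact map_comap_of_surjective (mul_left_surjective₀ hK.ne') _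

section LiminfLimsup

variable {α : Type*} {l : Filter α} {u v r : α → ℝ}

lemma eventually_mul_lt_of_tendsto_one (hr : Tendsto r l (𝓝 1)) {a b : ℝ} (hab : a < b) :
    ∀ᶠ x in l, 0 ≤ r x ∧ a * r x < b := by
  have h : Tendsto (fun x => a * r x) l (𝓝 (a * 1)) := hr.const_mul a
  rw [mul_one] at h
  exact (hr.eventually_const_le one_pos).and (h.eventually_lt_const hab)

/-- Comparing with real thresholds `a < b` keeps the product in `ℝ`: where `v x < a` and `r x` is
close to `1`, one gets `u x ≤ a * r x < b`. -/
lemma liminf_le_liminf_of_le_mul (hr : Tendsto r l (𝓝 1)) (h : ∀ᶠ x in l, u x ≤ v x * r x) :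
    liminf (fun x => (u x : EReal)) l ≤ liminf (fun x => (v x : EReal)) l := by
  refine EReal.le_of_forall_lt_iff_le.1 fun b hb => ?_
  obtain ⟨a, ha, hab⟩ := EReal.lt_iff_exists_real_btwn.1 hb
  refine liminf_le_of_frequently_le' ?_
  refine ((frequently_lt_of_liminf_lt (by isBoundedDefault) ha).and_eventually
    (h.and (eventually_mul_lt_of_tendsto_one hr (EReal.coe_lt_coe_iff.1 hab)))).mono ?_
  rintro x ⟨hx, hux, hrx, hlt⟩
  exact EReal.coe_le_coe_iff.2
    ((hux.trans (mul_le_mul_of_nonneg_right (EReal.coe_lt_coe_iff.1 hx).le hrx)).trans hlt.le)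

lemma limsup_le_limsup_of_le_mul (hr : Tendsto r l (𝓝 1)) (h : ∀ᶠ x in l, u x ≤ v x * r x) :
    limsup (fun x => (u x : EReal)) l ≤ limsup (fun x => (v x : EReal)) l := by
  refine EReal.le_of_forall_lt_iff_le.1 fun b hb => ?_
  obtain ⟨a, ha, hab⟩ := EReal.lt_iff_exists_real_btwn.1 hb
  refine limsup_le_of_le (by isBoundedDefault) ?_
  filter_upwards [eventually_lt_of_limsup_lt ha, h,
    eventually_mul_lt_of_tendsto_one hr (EReal.coe_lt_coe_iff.1 hab)] with x hx hux ⟨hrx, hlt⟩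
  exact EReal.coe_le_coe_iff.2
    ((hux.trans (mul_le_mul_of_nonneg_right (EReal.coe_lt_coe_iff.1 hx).le hrx)).trans hlt.le)

end LiminfLimsup

lemma lowerBoxDim_image_le {K : ℝ≥0} (hK : 0 < K) {φ : X → Y} (hφ : LipschitzWith K φ)
    {F : Set X} (hF : TotallyBounded F) : lowerBoxDim (φ '' F) ≤ lowerBoxDim F := by
  unfold lowerBoxDim
  conv_lhs => rw [← map_mul_left_nhdsGT_zero (K := K) hK]
  exact liminf_le_liminf_of_le_mul (tendsto_log_div_log_mul hK) (boxQuotient_image_le hK hφ hF)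

lemma upperBoxDim_image_le {K : ℝ≥0} (hK : 0 < K) {φ : X → Y} (hφ : LipschitzWith K φ)
    {F : Set X} (hF : TotallyBounded F) : upperBoxDim (φ '' F) ≤ upperBoxDim F := by
  unfold upperBoxDim
  conv_lhs => rw [← map_mul_left_nhdsGT_zero (K := K) hK]
  exact limsup_le_limsup_of_le_mul (tendsto_log_div_log_mul hK) (boxQuotient_image_le hK hφ hF)

lemma tendsto_boxQuotient_iff {F : Set X} {β : ℝ} :
    Tendsto (boxQuotient F) (𝓝[>] (0 : ℝ)) (𝓝 β) ↔
      lowerBoxDim F = (β : EReal) ∧ upperBoxDim F = (β : EReal) := by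
  rw [← EReal.tendsto_coe]
  exact ⟨fun h => ⟨h.liminf_eq, h.limsup_eq⟩, fun h => tendsto_of_liminf_eq_limsup h.1 h.2⟩

end LipschitzInvariance

/-! ### Packing dimension under Lipschitz maps, and invariance of all dimensions. -/

section Packing

variable {E : Type*} [NormedAddCommGroup E] [NormedSpace ℝ E] [Nontrivial E]

/-- The lower bound uses antipodal points `x ± v` with `‖v‖ = r`; in a general metric space the
diameter may be smaller than `2 * r`. -/
lemma ediam_closedBall_eq (x : E) {r : ℝ} (hr : 0 ≤ r) :
    Metric.ediam (Metric.closedBall x r) = ENNReal.ofReal (2 * r) := by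
  refine le_antisymm (Metric.ediam_le fun y hy z hz => ?_) ?_
  · rw [edist_dist]
    refine ENNReal.ofReal_le_ofReal ?_
    have := dist_triangle_right y z x
    rw [Metric.mem_closedBall] at hy hz
    linarith
  · obtain ⟨v, hv⟩ := exists_norm_eq E hr
    have h₁ : x + v ∈ Metric.closedBall x r := by simp [hv]
    have h₂ : x - v ∈ Metric.closedBall x r := by simp [hv]
    refine le_trans (le_of_eq ?_) (Metric.edist_le_ediam_of_mem h₁ h₂)
    rw [edist_dist, dist_eq_norm, show x + v - (x - v) = (2 : ℝ) • v by rw [two_smul]; abel,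
      norm_smul, hv, Real.norm_two]

/-- A packing of the image pulls back: put balls of radius `r i / K` at preimages of the centres.
Each is mapped into the original ball, so disjointness is inherited, and diameters scale by exactly
`K`. -/
lemma packingPre_image_le {K : ℝ≥0} (hK : 0 < K) {φ : E → E} (hφ : LipschitzWith K φ)
    {s : ℝ} (hs : 0 ≤ s) (δ : ℝ) (F : Set E) :
    packingPre s (K * δ) (φ '' F) ≤ (K : ℝ≥0∞) ^ s * packingPre s δ F := by
  have hK' : (0 : ℝ) < K := hK
  refine iSup_le fun c => iSup_le fun r => iSup_le fun J => iSup_le fun hJ => iSup_le fun hd => ?_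
  have hex : ∀ i, ∃ x, i ∈ J → x ∈ F ∧ φ x = c i := fun i => by
    by_cases hi : i ∈ J
    · obtain ⟨x, hx⟩ := (hJ i hi).1
      exact ⟨x, fun _ => hx⟩
    · exact ⟨0, fun h => absurd h hi⟩
  choose x hx using hex
  have hJ' : ∀ i ∈ J, x i ∈ F ∧ 0 < r i / K ∧ r i / K ≤ δ := fun i hi =>
    ⟨(hx i hi).1, div_pos (hJ i hi).2.1 hK', (div_le_iff₀' hK').2 (hJ i hi).2.2⟩
  have hd' : J.PairwiseDisjoint fun i => Metric.closedBall (x i) (r i / K) := by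
    intro i hi j hj hij
    have hmaps : ∀ i ∈ J, Metric.closedBall (x i) (r i / K) ⊆
        φ ⁻¹' Metric.closedBall (c i) (r i) := fun i hi y hy => by
      have := hφ.mapsTo_closedBall (x i) (r i / K) hy
      rwa [(hx i hi).2, mul_div_cancel₀ _ hK'.ne'] at this
    exact ((hd hi hj hij).preimage φ).mono (hmaps i hi) (hmaps j hj)
  calc ∑' i : J, Metric.ediam (Metric.closedBall (c i) (r i)) ^ s
      = ∑' i : J, (K : ℝ≥0∞) ^ s * Metric.ediam (Metric.closedBall (x i) (r i / K)) ^ s := by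
        refine tsum_congr fun i => ?_
        have hi := (hJ i i.2).2.1
        rw [← ENNReal.mul_rpow_of_nonneg _ _ hs, ediam_closedBall_eq _ hi.le,
          ediam_closedBall_eq _ (div_pos hi hK').le, ← ENNReal.ofReal_coe_nnreal,
          ← ENNReal.ofReal_mul hK'.le]
        congr 2
        field_simp
    _ = (K : ℝ≥0∞) ^ s * ∑' i : J, Metric.ediam (Metric.closedBall (x i) (r i / K)) ^ s :=
        ENNReal.tsum_mul_left
    _ ≤ _ := by
        gcongr
        exact le_iSup_of_le x <| le_iSup_of_le (fun i => r i / K) <| le_iSup_of_le J <|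
          le_iSup_of_le hJ' <| le_iSup_of_le hd' le_rfl

lemma packingPreZero_image_le {K : ℝ≥0} (hK : 0 < K) {φ : E → E} (hφ : LipschitzWith K φ)
    {s : ℝ} (hs : 0 ≤ s) (F : Set E) :
    packingPreZero s (φ '' F) ≤ (K : ℝ≥0∞) ^ s * packingPreZero s F := by
  have h0 : (K : ℝ≥0∞) ^ s ≠ 0 :=
    (ENNReal.rpow_pos (by exact_mod_cast hK) ENNReal.coe_ne_top).ne'
  have htop : (K : ℝ≥0∞) ^ s ≠ ∞ := ENNReal.rpow_ne_top_of_nonneg hs ENNReal.coe_ne_top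
  unfold packingPreZero
  rw [ENNReal.mul_iInf_of_ne h0 htop]
  refine le_iInf fun δ => ?_
  rw [ENNReal.mul_iInf_of_ne h0 htop]
  exact le_iInf fun hδ => (iInf₂_le (K * δ) (mul_pos (by exact_mod_cast hK) hδ)).trans
    (packingPre_image_le hK hφ hs δ F)

lemma packingMeasure_image_le {K : ℝ≥0} (hK : 0 < K) {φ : E → E} (hφ : LipschitzWith K φ)
    {s : ℝ} (hs : 0 ≤ s) (F : Set E) :
    packingMeasure s (φ '' F) ≤ (K : ℝ≥0∞) ^ s * packingMeasure s F := by
  have h0 : (K : ℝ≥0∞) ^ s ≠ 0 :=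
    (ENNReal.rpow_pos (by exact_mod_cast hK) ENNReal.coe_ne_top).ne'
  have htop : (K : ℝ≥0∞) ^ s ≠ ∞ := ENNReal.rpow_ne_top_of_nonneg hs ENNReal.coe_ne_top
  conv_rhs => unfold packingMeasure
  rw [ENNReal.mul_iInf_of_ne h0 htop]
  refine le_iInf fun t => ?_
  rw [ENNReal.mul_iInf_of_ne h0 htop]
  refine le_iInf fun ht => ?_
  rw [← ENNReal.tsum_mul_left]
  refine (iInf₂_le (fun i => φ '' t i) ?_).trans
    (ENNReal.tsum_le_tsum fun i => packingPreZero_image_le hK hφ hs (t i))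
  rw [← image_iUnion]
  exact image_mono ht

lemma packingDim_image_le {K : ℝ≥0} (hK : 0 < K) {φ : E → E} (hφ : LipschitzWith K φ)
    (F : Set E) : packingDim (φ '' F) ≤ packingDim F := by
  refine le_iInf₂ fun s hs => iInf₂_le s ?_
  have := packingMeasure_image_le hK hφ s.coe_nonneg F
  rwa [hs, mul_zero, nonpos_iff_eq_zero] at this

/-- All the dimensions are invariant under maps which are Lipschitz in both directions. -/
lemma FractalDimension.HasDim.image_of_lipschitz {D : FractalDimension} {F : Set E} {β : ℝ}
    (h : D.HasDim F β) (hF : TotallyBounded F) {φ ψ : E → E} {K L : ℝ≥0}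
    (hφ : LipschitzWith K φ) (hψ : LipschitzWith L ψ) (hψφ : ψ '' (φ '' F) = F) :
    D.HasDim (φ '' F) β := by
  -- The constants are enlarged to be positive, since the scaling estimates divide by them.
  replace hφ : LipschitzWith (K + 1) φ := hφ.weaken (by simp)
  replace hψ : LipschitzWith (L + 1) ψ := hψ.weaken (by simp)
  have hK : 0 < K + 1 := by positivity
  have hL : 0 < L + 1 := by positivity
  have hF' : TotallyBounded (φ '' F) := hF.image hφ.uniformContinuous
  have hl : lowerBoxDim (φ '' F) = lowerBoxDim F :=
    (lowerBoxDim_image_le hK hφ hF).antisymm <| by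
      simpa only [hψφ] using lowerBoxDim_image_le hL hψ hF'
  have hu : upperBoxDim (φ '' F) = upperBoxDim F :=
    (upperBoxDim_image_le hK hφ hF).antisymm <| by
      simpa only [hψφ] using upperBoxDim_image_le hL hψ hF'
  cases D with
  | hausdorff =>
    have : dimH (φ '' F) = dimH F := (hφ.dimH_image_le F).antisymm <| by
      simpa only [hψφ] using hψ.dimH_image_le (φ '' F)
    exact (congrArg _ this).trans h
  | lowerBox => exact hl.trans h
  | upperBox => exact hu.trans h
  | box =>
    have h' := tendsto_boxQuotient_iff.1 h
    exact tendsto_boxQuotient_iff.2 ⟨hl.trans h'.1, hu.trans h'.2⟩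
  | packing =>
    have : packingDim (φ '' F) = packingDim F := (packingDim_image_le hK hφ F).antisymm <| by
      simpa only [hψφ] using packingDim_image_le hL hψ (φ '' F)
    exact (congrArg _ this).trans h

end Packing

/-! ### Shears of graphs, and density of `S D β`. -/

section Graphs

/-- The plane map `(x, y) ↦ (x, c y + q x)`. -/
def shear (c : ℝ) (q : ℝ → ℝ) (v : EuclideanSpace ℝ (Fin 2)) : EuclideanSpace ℝ (Fin 2) :=
  !₂[v 0, c * v 1 + q (v 0)]

lemma exists_lipschitzWith_shear (c : ℝ) {q : ℝ → ℝ} {K : ℝ≥0} (hq : LipschitzWith K q) :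
    ∃ L, LipschitzWith L (shear c q) := by
  have h (i : Fin 2) : LipschitzWith 1 fun v : EuclideanSpace ℝ (Fin 2) => v i :=
    LipschitzWith.mk_one fun v w => by
      simpa [dist_eq_norm] using PiLp.norm_apply_le (v - w) i
  have h₁ : LipschitzWith (‖c‖₊ * 1 + K * 1)
      fun v : EuclideanSpace ℝ (Fin 2) => c * v 1 + q (v 0) :=
    ((lipschitzWith_smul c).comp (h 1)).add (hq.comp (h 0))
  have h₂ : LipschitzWith (max 1 (‖c‖₊ * 1 + K * 1))
      fun v : EuclideanSpace ℝ (Fin 2) => ![v 0, c * v 1 + q (v 0)] := by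
    refine LipschitzWith.of_dist_le_mul fun v w => (dist_pi_le_iff (by positivity)).2 fun i => ?_
    fin_cases i
    · exact ((h 0).weaken (le_max_left _ _)).dist_le_mul v w
    · exact (h₁.weaken (le_max_right _ _)).dist_le_mul v w
  exact ⟨_, (PiLp.lipschitzWith_toLp 2 (fun _ : Fin 2 => ℝ)).comp h₂⟩

lemma image_shear_graph01 (c : ℝ) (q g : ℝ → ℝ) :
    shear c q '' graph01 g = graph01 fun x => c * g x + q x := by
  simp only [graph01, image_image]
  rfl

lemma graph01_congr {g h : ℝ → ℝ} (hgh : EqOn g h (Icc 0 1)) : graph01 g = graph01 h :=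
  image_congr fun x hx => by rw [hgh hx]

lemma isCompact_graph01 {g : ℝ → ℝ} (hg : ContinuousOn g (Icc 0 1)) :
    IsCompact (graph01 g) := by
  refine isCompact_Icc.image_of_continuousOn ?_
  refine (PiLp.continuous_toLp 2 (fun _ : Fin 2 => ℝ)).comp_continuousOn
    (continuousOn_pi.2 fun i => ?_)
  fin_cases i
  · exact continuousOn_id
  · exact hg

lemma S_mul_add_lipschitz {D : FractalDimension} {β : ℝ} {g : ℝ → ℝ} (hg : g ∈ S D β)
    {c : ℝ} (hc : c ≠ 0) {q : ℝ → ℝ} {K : ℝ≥0} (hq : LipschitzWith K q) :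
    (fun x => c * g x + q x) ∈ S D β := by
  refine ⟨(hg.1.const_mul c).add hq.continuous.continuousOn, ?_⟩
  obtain ⟨L, hL⟩ := exists_lipschitzWith_shear c hq
  -- The inverse shear: `y ↦ c⁻¹ * y - c⁻¹ * q x`.
  obtain ⟨M, hM⟩ := exists_lipschitzWith_shear c⁻¹ ((lipschitzWith_smul (-c⁻¹)).comp hq)
  rw [← image_shear_graph01]
  refine hg.2.image_of_lipschitz (isCompact_graph01 hg.1).totallyBounded hL hM ?_
  rw [image_shear_graph01, image_shear_graph01]
  refine graph01_congr fun x _ => ?_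
  simp only [Function.comp_apply, smul_eq_mul]
  field_simp
  ring

lemma exists_lipschitzWith_near {u : ℝ → ℝ} (hu : ContinuousOn u (Icc 0 1)) {ε : ℝ}
    (hε : 0 < ε) : ∃ (K : ℝ≥0) (q : ℝ → ℝ), LipschitzWith K q ∧
      ∀ x ∈ Icc (0 : ℝ) 1, |q x - u x| < ε := by
  obtain ⟨p, hp⟩ := exists_polynomial_near_of_continuousOn 0 1 u hu ε hε
  have hp₁ : ContDiff ℝ 1 fun x => p.eval x := by
    simpa using p.contDiff_aeval (𝕜 := ℝ) 1
  -- A polynomial need be Lipschitz only on the compact interval, so its restriction is extended to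
  -- a Lipschitz function on `ℝ`.
  obtain ⟨K, hK⟩ := hp₁.contDiffOn.exists_lipschitzOnWith one_ne_zero
    (convex_Icc (0 : ℝ) 1) isCompact_Icc
  obtain ⟨q, hq, hqp⟩ := hK.extend_real
  exact ⟨K, q, hq, fun x hx => by rw [← hqp hx]; exact hp x hx⟩

lemma S_dense {D : FractalDimension} {β : ℝ} {g : ℝ → ℝ} (hg : g ∈ S D β) {u : ℝ → ℝ}
    (hu : ContinuousOn u (Icc 0 1)) {ε : ℝ} (hε : 0 < ε) :
    ∃ h ∈ S D β, ∀ x ∈ Icc (0 : ℝ) 1, |h x - u x| < ε := by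
  obtain ⟨K, q, hq, hqu⟩ := exists_lipschitzWith_near hu (half_pos hε)
  obtain ⟨M, hM⟩ := isCompact_Icc.exists_bound_of_continuousOn hg.1
  have hM0 : 0 ≤ M := (norm_nonneg _).trans (hM 0 (by simp))
  -- With `M + 1` instead of `M` the coefficient is defined and nonzero even if `g` vanishes on
  -- `[0,1]`.
  have hc : 0 < ε / (2 * (M + 1)) := by positivity
  refine ⟨_, S_mul_add_lipschitz hg hc.ne' hq, fun x hx => ?_⟩
  have h₁ : |ε / (2 * (M + 1)) * g x| < ε / 2 := by
    rw [abs_mul, abs_of_pos hc]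
    calc ε / (2 * (M + 1)) * |g x| < ε / (2 * (M + 1)) * (M + 1) := by
          gcongr
          exact (hM x hx).trans_lt (lt_add_one M)
      _ = ε / 2 := by field_simp
  calc |ε / (2 * (M + 1)) * g x + q x - u x|
      ≤ |ε / (2 * (M + 1)) * g x| + |q x - u x| := by
        rw [add_sub_assoc]; exact abs_add_le _ _
    _ < ε / 2 + ε / 2 := add_lt_add h₁ (hqu x hx)
    _ = ε := add_halves ε

end Graphs

/-! ### Regularity and stability of iterated primitives. -/

section IteratedPrimitive

variable {f g : ℝ → ℝ}

lemma hasDerivWithinAt_primitive (hg : ContinuousOn g (Icc 0 1)) (a : ℝ) {x : ℝ}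
    (hx : x ∈ Icc (0 : ℝ) 1) :
    HasDerivWithinAt (fun y => a + ∫ t in (0 : ℝ)..y, g t) (g x) (Icc 0 1) x := by
  -- Nothing is known about `g` outside `[0,1]`; its extension by the endpoint values is continuous
  -- on `ℝ` and has the same integrals over `[0, y]`.
  have hG : Continuous (IccExtend (zero_le_one' ℝ) ((Icc 0 1).domRestrict g)) :=
    hg.domRestrict.Icc_extend'
  have heq : ∀ t ∈ Icc (0 : ℝ) 1, IccExtend (zero_le_one' ℝ) ((Icc 0 1).domRestrict g) t = g t :=
    fun t ht => by rw [IccExtend_of_mem _ _ ht]; rfl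
  have hint : ∀ y ∈ Icc (0 : ℝ) 1, (a + ∫ t in (0 : ℝ)..y, g t) =
      a + ∫ t in (0 : ℝ)..y, IccExtend (zero_le_one' ℝ) ((Icc 0 1).domRestrict g) t :=
    fun y hy => by
      congr 1
      refine intervalIntegral.integral_congr fun t ht => ?_
      rw [uIcc_of_le hy.1] at ht
      exact (heq t ⟨ht.1, ht.2.trans hy.2⟩).symm
  have h := ((hG.integral_hasStrictDerivAt 0 x).hasDerivAt.const_add a).hasDerivWithinAt
    (s := Icc 0 1)
  rw [heq x hx] at h
  exact h.congr hint (hint x hx)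

lemma continuousOn_iteratedPrimitive (hg : ContinuousOn g (Icc 0 1)) (k : ℕ) (a : ℕ → ℝ) :
    ContinuousOn (iteratedPrimitive g k a) (Icc 0 1) := by
  induction k generalizing a with
  | zero => exact hg
  | succ k ih => exact fun x hx => (hasDerivWithinAt_primitive (ih _) _ hx).continuousWithinAt

lemma hasDerivWithinAt_iteratedPrimitive_succ (hg : ContinuousOn g (Icc 0 1)) (k : ℕ)
    (a : ℕ → ℝ) {x : ℝ} (hx : x ∈ Icc (0 : ℝ) 1) :
    HasDerivWithinAt (iteratedPrimitive g (k + 1) a)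
      (iteratedPrimitive g k (fun j => a (j + 1)) x) (Icc 0 1) x :=
  hasDerivWithinAt_primitive (continuousOn_iteratedPrimitive hg _ _) _ hx

lemma derivWithin_iteratedPrimitive_succ (hg : ContinuousOn g (Icc 0 1)) (k : ℕ) (a : ℕ → ℝ) :
    EqOn (derivWithin (iteratedPrimitive g (k + 1) a) (Icc 0 1))
      (iteratedPrimitive g k (fun j => a (j + 1))) (Icc 0 1) := fun x hx =>
  (hasDerivWithinAt_iteratedPrimitive_succ hg k a hx).derivWithin
    (uniqueDiffOn_Icc_zero_one x hx)

lemma contDiffOn_iteratedPrimitive (hg : ContinuousOn g (Icc 0 1)) (k : ℕ) (a : ℕ → ℝ) :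
    ContDiffOn ℝ k (iteratedPrimitive g k a) (Icc 0 1) := by
  induction k generalizing a with
  | zero => exact contDiffOn_zero.2 hg
  | succ k ih =>
    push_cast
    refine (contDiffOn_succ_iff_derivWithin uniqueDiffOn_Icc_zero_one).2
      ⟨fun x hx => (hasDerivWithinAt_iteratedPrimitive_succ hg k a hx).differentiableWithinAt,
        by simp, (ih _).congr (derivWithin_iteratedPrimitive_succ hg k a)⟩

lemma iteratedDerivWithin_iteratedPrimitive (hg : ContinuousOn g (Icc 0 1)) (k : ℕ)
    (a : ℕ → ℝ) :
    EqOn (iteratedDerivWithin k (iteratedPrimitive g k a) (Icc 0 1)) g (Icc 0 1) := by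
  induction k generalizing a with
  | zero => intro x _; simp [iteratedPrimitive]
  | succ k ih =>
    rw [iteratedDerivWithin_succ']
    exact (iteratedDerivWithin_congr (derivWithin_iteratedPrimitive_succ hg k a)).trans (ih _)

/-- Induction on `k`, applied to the derivative of `f`: the difference vanishes at `0` and its
derivative is bounded by `ε`, so the mean value inequality on an interval of length `1` reproduces
the same `ε`. -/
lemma abs_iteratedPrimitive_sub_le (hg : ContinuousOn g (Icc 0 1)) {k : ℕ}
    (hf : ContDiffOn ℝ k f (Icc 0 1)) {ε : ℝ}
    (h : ∀ x ∈ Icc (0 : ℝ) 1, |g x - iteratedDerivWithin k f (Icc 0 1) x| ≤ ε) :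
    ∀ x ∈ Icc (0 : ℝ) 1, |iteratedPrimitive g k
      (fun j => iteratedDerivWithin j f (Icc 0 1) 0) x - f x| ≤ ε := by
  induction k generalizing f with
  | zero => simpa [iteratedPrimitive] using h
  | succ k ih =>
    push_cast at hf
    obtain ⟨hdiff, -, hf'⟩ := (contDiffOn_succ_iff_derivWithin uniqueDiffOn_Icc_zero_one).1 hf
    have ih' := ih hf' (by simpa only [iteratedDerivWithin_succ'] using h)
    have hd : ∀ x ∈ Icc (0 : ℝ) 1, HasDerivWithinAt (fun y => iteratedPrimitive g (k + 1)
        (fun j => iteratedDerivWithin j f (Icc 0 1) 0) y - f y)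
        (iteratedPrimitive g k (fun j => iteratedDerivWithin j
          (derivWithin f (Icc 0 1)) (Icc 0 1) 0) x - derivWithin f (Icc 0 1) x)
        (Icc 0 1) x := fun x hx => by
      have h₁ := hasDerivWithinAt_iteratedPrimitive_succ hg k
        (fun j => iteratedDerivWithin j f (Icc 0 1) 0) hx
      simp only [iteratedDerivWithin_succ'] at h₁
      exact h₁.sub (hdiff x hx).hasDerivWithinAt
    intro x hx
    have hmv := (convex_Icc (0 : ℝ) 1).norm_image_sub_le_of_norm_hasDerivWithin_le hd ih'
      (left_mem_Icc.2 zero_le_one) hx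
    have h0 : iteratedPrimitive g (k + 1)
        (fun j => iteratedDerivWithin j f (Icc 0 1) 0) 0 - f 0 = 0 := by
      simp [iteratedPrimitive]
    have hε : 0 ≤ ε := (abs_nonneg _).trans (h x hx)
    rw [h0, sub_zero, sub_zero, Real.norm_eq_abs, Real.norm_eq_abs, abs_of_nonneg hx.1] at hmv
    exact hmv.trans (mul_le_of_le_one_right hε hx.2)

lemma tendstoUniformlyOn_iteratedPrimitive {ι : Type*} {l : Filter ι} {G : ι → ℝ → ℝ}
    (hG : ∀ n, ContinuousOn (G n) (Icc 0 1)) {k : ℕ} (hf : ContDiffOn ℝ k f (Icc 0 1))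
    (h : TendstoUniformlyOn G (iteratedDerivWithin k f (Icc 0 1)) l (Icc 0 1)) :
    TendstoUniformlyOn (fun n => iteratedPrimitive (G n) k
      (fun j => iteratedDerivWithin j f (Icc 0 1) 0)) f l (Icc 0 1) := by
  rw [Metric.tendstoUniformlyOn_iff] at h ⊢
  intro ε hε
  filter_upwards [h (ε / 2) (half_pos hε)] with n hn x hx
  rw [dist_comm, Real.dist_eq]
  refine (abs_iteratedPrimitive_sub_le (hG n) hf (fun y hy => ?_) x hx).trans_lt (half_lt_self hε)
  have := (hn y hy).le
  rwa [dist_comm, Real.dist_eq] at this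

end IteratedPrimitive

end FractalApprox

/-! ### The approximation theorem. -/

theorem theorem3p6 (D : FractalApprox.FractalDimension) (β : ℝ) (hβ : β ∈ Set.Icc (1 : ℝ) 2)
    (k : ℕ) (hk : 1 ≤ k) (f : ℝ → ℝ) (hf : ContDiffOn ℝ k f (Set.Icc 0 1))
    (hdim : D.HasDim
      (FractalApprox.graph01 (iteratedDerivWithin k f (Set.Icc 0 1))) β) :
    -- there are approximants of `f`, obtained by integrating approximants of its derivative
    (∃ (g F : ℕ → ℝ → ℝ),
      (∀ n, g n ∈ FractalApprox.S D β ∧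
        ¬ Set.EqOn (g n) (iteratedDerivWithin k f (Set.Icc 0 1)) (Set.Icc 0 1)) ∧
      TendstoUniformlyOn g (iteratedDerivWithin k f (Set.Icc 0 1)) Filter.atTop (Set.Icc 0 1) ∧
      (∀ n, F n = FractalApprox.iteratedPrimitive (g n) k
        (fun j => iteratedDerivWithin j f (Set.Icc 0 1) 0)) ∧
      (∀ n, ContDiffOn ℝ k (F n) (Set.Icc 0 1) ∧
        Set.EqOn (iteratedDerivWithin k (F n) (Set.Icc 0 1)) (g n) (Set.Icc 0 1) ∧
        D.HasDim (FractalApprox.graph01 (iteratedDerivWithin k (F n) (Set.Icc 0 1))) β) ∧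
      TendstoUniformlyOn F f Filter.atTop (Set.Icc 0 1)) ∧
    -- every sequence of `S_β` that approximates the derivative yields approximants of `f`
    (∀ g : ℕ → ℝ → ℝ, (∀ n, g n ∈ FractalApprox.S D β) →
      TendstoUniformlyOn g (iteratedDerivWithin k f (Set.Icc 0 1)) Filter.atTop (Set.Icc 0 1) →
      ∀ F : ℕ → ℝ → ℝ,
      (∀ n, F n = FractalApprox.iteratedPrimitive (g n) k
        (fun j => iteratedDerivWithin j f (Set.Icc 0 1) 0)) →
      (∀ n, ContDiffOn ℝ k (F n) (Set.Icc 0 1) ∧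
        Set.EqOn (iteratedDerivWithin k (F n) (Set.Icc 0 1)) (g n) (Set.Icc 0 1) ∧
        D.HasDim (FractalApprox.graph01 (iteratedDerivWithin k (F n) (Set.Icc 0 1))) β) ∧
      TendstoUniformlyOn F f Filter.atTop (Set.Icc 0 1)) ∧
    -- `S_β` is dense in `C[0,1]` for the supremum norm
    (∀ u : ℝ → ℝ, ContinuousOn u (Set.Icc 0 1) → ∀ ε : ℝ, 0 < ε →
      ∃ h ∈ FractalApprox.S D β, ∀ x ∈ Set.Icc (0 : ℝ) 1, |h x - u x| < ε) := by
  have hg₀ : iteratedDerivWithin k f (Set.Icc 0 1) ∈ FractalApprox.S D β :=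
    ⟨hf.continuousOn_iteratedDerivWithin le_rfl uniqueDiffOn_Icc_zero_one, hdim⟩
  have key : ∀ g : ℕ → ℝ → ℝ, (∀ n, g n ∈ FractalApprox.S D β) →
      TendstoUniformlyOn g (iteratedDerivWithin k f (Set.Icc 0 1)) Filter.atTop (Set.Icc 0 1) →
      ∀ F : ℕ → ℝ → ℝ,
      (∀ n, F n = FractalApprox.iteratedPrimitive (g n) k
        (fun j => iteratedDerivWithin j f (Set.Icc 0 1) 0)) →
      (∀ n, ContDiffOn ℝ k (F n) (Set.Icc 0 1) ∧
        Set.EqOn (iteratedDerivWithin k (F n) (Set.Icc 0 1)) (g n) (Set.Icc 0 1) ∧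
        D.HasDim (FractalApprox.graph01 (iteratedDerivWithin k (F n) (Set.Icc 0 1))) β) ∧
      TendstoUniformlyOn F f Filter.atTop (Set.Icc 0 1) := by
    intro g hg hlim F hF
    obtain rfl : F = _ := funext hF
    refine ⟨fun n => ?_, FractalApprox.tendstoUniformlyOn_iteratedPrimitive
      (fun n => (hg n).1) hf hlim⟩
    have heq := FractalApprox.iteratedDerivWithin_iteratedPrimitive (hg n).1 k
      (fun j => iteratedDerivWithin j f (Set.Icc 0 1) 0)
    refine ⟨FractalApprox.contDiffOn_iteratedPrimitive (hg n).1 k _, heq, ?_⟩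
    rw [FractalApprox.graph01_congr heq]
    exact (hg n).2
  refine ⟨?_, key, fun u hu ε hε => FractalApprox.S_dense hg₀ hu hε⟩
  -- The factor `1 *` matches the form `c * g x + q x` of `S_mul_add_lipschitz`, with `c = 1` and
  -- `q` constant.
  let g : ℕ → ℝ → ℝ := fun n x =>
    1 * iteratedDerivWithin k f (Set.Icc 0 1) x + 1 / ((n : ℝ) + 1)
  have hg : ∀ n, g n ∈ FractalApprox.S D β := fun n =>
    FractalApprox.S_mul_add_lipschitz hg₀ one_ne_zero (LipschitzWith.const (1 / ((n : ℝ) + 1)))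
  have hlim : TendstoUniformlyOn g (iteratedDerivWithin k f (Set.Icc 0 1)) Filter.atTop
      (Set.Icc 0 1) := by
    rw [Metric.tendstoUniformlyOn_iff]
    intro ε hε
    filter_upwards [tendsto_one_div_add_atTop_nhds_zero_nat.eventually_lt_const hε] with n hn x _
    have hpos : (0 : ℝ) < 1 / ((n : ℝ) + 1) := by positivity
    rw [dist_comm, Real.dist_eq, show g n x - _ = 1 / ((n : ℝ) + 1) by simp [g], abs_of_pos hpos]
    exact hn
  refine ⟨g, _, fun n => ⟨hg n, fun h => ?_⟩, hlim, fun n => rfl, key g hg hlim _ fun n => rfl⟩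
  have h0 := h (Set.left_mem_Icc.2 zero_le_one)
  have hpos : (0 : ℝ) < 1 / ((n : ℝ) + 1) := by positivity
  simp only [g] at h0
  linarith
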